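/- Let $X$ be a real Banach space with continuous dual $X^*$, let $C\subseteq X$ be closed and convex, and suppose that $$\mathrm{sqri}(C)=\{x\in C:\ \mathrm{cone}(C-x)\text{ is a closed linear subspace of }X\}\neq\emptyset,$$ where $\mathrm{cone}(U)=\bigcup_{t\ge 0}tU$. Let $F:C\times C\to\mathbb{R}$ satisfy $F(x,x)=0$ for all $x\in C$, and let $F$ be $BO$-maximal monotone (Blum--Oettli maximal monotone), i.e. $F$ is monotone ($F(x,y)+F(y,x)\le 0$ for all $x,y\in C$) and for every $(x,x^*)\in C\times X^*$ $$F(y,x)+\langle x^*,y-x\rangle\le 0\ \ \forall y\in C\quad\Longrightarrow\quad F(x,y)\ge\langle x^*,y-x\rangle\ \ \forall y\in C.$$ If $F(x,\cdot)$ is convex and lower semicontinuous on $C$ for all $x\in C$, then $F$ is maximal monotone, i.e. $F$ is monotone and the operator $A^F:X\rightrightarrows X^*$ given by $$A^F(x)=\{x^*\in X^*:\ F(x,y)-F(x,x)\ge\langle x^*,y-x\rangle\ \ \forall y\in C\}\ \text{ if }x\in C,\qquad A^F(x)=\emptyset\ \text{ otherwise},$$ is maximal monotone: it is monotone ($\langle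 y^*-x^*,y-x\rangle\ge 0$ whenever $x^*\in A^F(x)$, $y^*\in A^F(y)$) and its graph is not properly included in the graph of any other monotone operator $X\rightrightarrows X^*$. -/

import Mathlib

namespace BifunctionTheory

/-- The conical hull `⋃_{t ≥ 0} t U` of a set `U`. -/
def conicalHull {X : Type*} [AddCommGroup X] [Module ℝ X] (U : Set X) : Set X :=
  {z | ∃ t : ℝ, 0 ≤ t ∧ ∃ u ∈ U, z = t • u}

/-- The strong quasi relative interior of a (convex) set `U`: the points `x ∈ U` such that the
conical hull of `U - x` is a closed linear subspace. -/
def sqri {X : Type*} [AddCommGroup X] [Module ℝ X] [TopologicalSpace X] (U : Set X) : Set X :=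
  {x | x ∈ U ∧ ∃ V : Submodule ℝ X,
    IsClosed (V : Set X) ∧ conicalHull ((fun u => u - x) '' U) = (V : Set X)}

variable {X : Type*} [NormedAddCommGroup X] [NormedSpace ℝ X]

/-- The graph of a multifunction `T : X ⇉ X*`. -/
def graph (T : X → Set (StrongDual ℝ X)) : Set (X × StrongDual ℝ X) :=
  {p | p.2 ∈ T p.1}

/-- Monotone operators `T : X ⇉ X*`. -/
def IsMonotoneOperator (T : X → Set (StrongDual ℝ X)) : Prop :=
  ∀ x y : X, ∀ x' ∈ T x, ∀ y' ∈ T y, 0 ≤ (y' - x') (y - x)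

/-- Maximal monotone operators: monotone operators whose graph is not properly included in the
graph of any other monotone operator. -/
def IsMaximalMonotoneOperator (T : X → Set (StrongDual ℝ X)) : Prop :=
  IsMonotoneOperator T ∧
    ∀ S : X → Set (StrongDual ℝ X), IsMonotoneOperator S → ¬ graph T ⊂ graph S

/-! A bifunction on `C ⊆ X` is represented by a map `F : X → X → ℝ`, of which only the values
`F x y` with `x ∈ C` and `y ∈ C` are ever used. -/

/-- A monotone bifunction on `C`. -/
def IsMonotoneBifunction (C : Set X) (F : X → X → ℝ) : Prop :=
  ∀ x ∈ C, ∀ y ∈ C, F x y + F y x ≤ 0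

/-- The operator `A^F : X ⇉ X*` of a bifunction `F` on `C`; it is empty-valued outside `C`. -/
def diagonalOperator (C : Set X) (F : X → X → ℝ) (x : X) : Set (StrongDual ℝ X) :=
  {x' | x ∈ C ∧ ∀ y ∈ C, x' (y - x) ≤ F x y - F x x}

/-- A maximal monotone bifunction on `C`: it is monotone and `A^F` is a maximal monotone
operator. -/
def IsMaximalMonotoneBifunction (C : Set X) (F : X → X → ℝ) : Prop :=
  IsMonotoneBifunction C F ∧ IsMaximalMonotoneOperator (diagonalOperator C F)

/-- A Blum-Oettli maximal monotone bifunction on `C`. -/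
def IsBOMaximalMonotoneBifunction (C : Set X) (F : X → X → ℝ) : Prop :=
  IsMonotoneBifunction C F ∧
    ∀ x ∈ C, ∀ x' : StrongDual ℝ X,
      (∀ y ∈ C, F y x + x' (y - x) ≤ 0) → ∀ y ∈ C, x' (y - x) ≤ F x y

end BifunctionTheory

open Filter Topology

/-! Let `(x₀, x')` be monotonically related to the graph of `A^F`. Subtracting `x' (y - x)` from `F`
reduces to `x' = 0`; by Blum-Oettli maximality it then suffices that `x₀ ∈ C` and that `F z x₀ ≤ 0`
for all `z ∈ C`.

A point `p` of the sqri supplies subgradients. Inside its closed subspace `V` the set `C - p` has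
interior by Baire, so `F w` is subdifferentiable at relative core points `w`, which include every
point other than `c` of a segment from `c ∈ C` to `p`.

If `x₀ ∉ C`, there is a functional normal to `C` at some `b` with `A^F b` nonempty, negative in the
direction `b - x₀`; adding a large multiple of it to a subgradient breaks the relation
(`nonneg_of_normal`). When `p - x₀ ∉ V`, take `b = p`. Otherwise `b` is the first point of `[x₀, p]`
in `C`, and a subgradient there is a weak-star limit of those on `(b, p]`
(`exists_subgradient_of_segment`).

Once `x₀ ∈ C`, testing the relation at core points near `x₀ + a • (z - x₀)` bounds `F z` there by an
error tending to zero; two passages to the limit give `F z x₀ ≤ 0`. -/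

namespace BifunctionTheory

/-! ### Baire, Hahn-Banach and Banach-Steinhaus tools -/

/-- A closed convex absorbing subset of a Banach space is a neighbourhood of the origin. -/
theorem zero_mem_interior_of_absorbing {E : Type*} [NormedAddCommGroup E] [NormedSpace ℝ E]
    [CompleteSpace E] {D : Set E} (hclosed : IsClosed D) (hconv : Convex ℝ D) (h0 : (0 : E) ∈ D)
    (habs : ∀ u, ∃ δ : ℝ, 0 < δ ∧ δ • u ∈ D) : (0 : E) ∈ interior D := by
  have hcover : ⋃ n : ℕ, (fun x : E => ((n : ℝ) + 1)⁻¹ • x) ⁻¹' D = Set.univ := by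
    refine Set.eq_univ_of_forall fun u => ?_
    obtain ⟨δ, hδ, hu⟩ := habs u
    obtain ⟨n, hn⟩ := exists_nat_one_div_lt hδ
    refine Set.mem_iUnion.2 ⟨n, ?_⟩
    have hn1 : (0 : ℝ) < (n : ℝ) + 1 := by positivity
    have hle : ((n : ℝ) + 1)⁻¹ / δ ≤ 1 := by
      rw [div_le_one hδ, inv_eq_one_div]; exact hn.le
    have := hconv.smul_mem_of_zero_mem h0 hu ⟨by positivity, hle⟩
    rwa [smul_smul, div_mul_cancel₀ _ hδ.ne'] at this
  obtain ⟨n, v, hv⟩ := nonempty_interior_of_iUnion_of_closed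
    (fun n : ℕ => hclosed.preimage (continuous_const_smul (((n : ℝ) + 1)⁻¹))) hcover
  have hn1 : ((n : ℝ) + 1)⁻¹ ≠ 0 := by positivity
  have hint : ((n : ℝ) + 1)⁻¹ • v ∈ interior D := by
    have := (Homeomorph.smulOfNeZero _ hn1 (α := E)).preimage_interior D
    have hv' : v ∈ (Homeomorph.smulOfNeZero (((n : ℝ) + 1)⁻¹) hn1 (α := E)) ⁻¹' interior D := by
      rw [this]; exact hv
    exact hv'
  set w := ((n : ℝ) + 1)⁻¹ • v
  -- The origin lies strictly between the interior point `w` and `δ • (-w) ∈ D`.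
  obtain ⟨δ, hδ, hw⟩ := habs (-w)
  have h1 : (0 : ℝ) < 1 + δ := by positivity
  have := hconv.combo_interior_self_mem_interior hint hw (a := δ / (1 + δ)) (b := 1 / (1 + δ))
    (by positivity) (by positivity) (by field_simp; ring)
  convert this using 1
  module

/-- Existence of a continuous affine minorant exact at the origin for a convex function on a
convex absorbing set with closed sublevel set. -/
theorem exists_subgradient_zero {E : Type*} [NormedAddCommGroup E] [NormedSpace ℝ E]
    [CompleteSpace E] {K : Set E} {f : E → ℝ} (h0 : (0 : E) ∈ K)
    (habs : ∀ u, ∃ δ : ℝ, 0 < δ ∧ δ • u ∈ K) (hf : ConvexOn ℝ K f) (hf0 : f 0 = 0)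
    (hclosed : IsClosed {u | u ∈ K ∧ f u ≤ 1}) :
    ∃ ℓ : StrongDual ℝ E, ∀ u ∈ K, ℓ u ≤ f u := by
  have hint : (0 : E) ∈ interior {u | u ∈ K ∧ f u ≤ 1} := by
    refine zero_mem_interior_of_absorbing hclosed (hf.convex_le 1) ⟨h0, by simp [hf0]⟩ ?_
    intro u
    obtain ⟨δ, hδ, hu⟩ := habs u
    have hm : (0 : ℝ) < max 1 (f (δ • u)) := lt_max_of_lt_left one_pos
    have hm1 : (max 1 (f (δ • u)))⁻¹ ≤ 1 := inv_le_one_of_one_le₀ (le_max_left _ _)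
    -- As `f 0 = 0`, convexity makes this shrinking bring the value down to at most `1`.
    refine ⟨(max 1 (f (δ • u)))⁻¹ * δ, by positivity, ?_, ?_⟩
    · rw [mul_smul]
      exact hf.1.smul_mem_of_zero_mem h0 hu ⟨by positivity, hm1⟩
    · have := hf.2 hu h0 (inv_nonneg.2 hm.le) (sub_nonneg.2 hm1) (by ring)
      simp only [smul_zero, add_zero, hf0, smul_eq_mul, mul_zero] at this
      rw [mul_smul]
      refine this.trans ?_
      rw [inv_mul_le_iff₀ hm, mul_one]
      exact le_max_right _ _
  obtain ⟨δ, hδ, hball⟩ := Metric.mem_nhds_iff.1 (mem_interior_iff_mem_nhds.1 hint)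
  have hlow : ∀ u ∈ K, -(2 / δ) * ‖u‖ ≤ f u := by
    intro u hu
    rcases eq_or_ne u 0 with rfl | hne
    · simp [hf0]
    have hn : 0 < ‖u‖ := norm_pos_iff.2 hne
    -- `-c • u` has norm `δ / 2`, so `f ≤ 1` there; convexity across the origin bounds `f u` below.
    set c : ℝ := δ / (2 * ‖u‖) with hc
    have hcpos : 0 < c := by positivity
    have hv : (-c) • u ∈ Metric.ball (0 : E) δ := by
      rw [mem_ball_zero_iff, norm_smul, norm_neg, Real.norm_of_nonneg hcpos.le, hc]
      field_simp
      linarith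
    obtain ⟨hvK, hv1⟩ := hball hv
    have := hf.2 hu hvK (by positivity : 0 ≤ c / (1 + c)) (by positivity : 0 ≤ 1 / (1 + c))
      (by field_simp; ring)
    have hz : (c / (1 + c)) • u + (1 / (1 + c)) • (-c) • u = 0 := by module
    rw [hz, hf0, smul_eq_mul, smul_eq_mul] at this
    have h2 : 0 ≤ c * f u + f ((-c) • u) := by
      have h3 := mul_nonneg (by positivity : (0 : ℝ) ≤ 1 + c) this
      have h4 : (1 + c) * (c / (1 + c) * f u + 1 / (1 + c) * f ((-c) • u))
        = c * f u + f ((-c) • u) := by field_simp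
      rwa [h4] at h3
    have h5 : 0 ≤ c * f u + 1 := h2.trans (by linarith)
    have h6 : c * (2 / δ * ‖u‖) = 1 := by rw [hc]; field_simp
    have h7 : 0 ≤ c * (f u + 2 / δ * ‖u‖) := by rw [mul_add, h6]; exact h5
    have := nonneg_of_mul_nonneg_right h7 hcpos
    linarith
  have hcone_open : IsOpen {q : E × ℝ | q.2 < -(2 / δ) * ‖q.1‖} :=
    isOpen_lt continuous_snd (by fun_prop)
  have hcone_conv : Convex ℝ {q : E × ℝ | q.2 < -(2 / δ) * ‖q.1‖} := by
    have := (convexOn_univ_norm (E := E)).smul (by positivity : 0 ≤ 2 / δ)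
    have := this.neg.convex_strict_hypograph
    simpa using this
  -- The lower bound separates an open downward cone from the epigraph; both touch the origin,
  -- forcing `s = 0`, and the slope of `φ` is the subgradient.
  obtain ⟨φ, s, hφ1, hφ2⟩ := geometric_hahn_banach_open hcone_conv hcone_open hf.convex_epigraph
    (Set.disjoint_left.2 fun q (hq : q.2 < _) ⟨hqK, hqf⟩ =>
      absurd ((hlow _ hqK).trans hqf) (not_le.2 hq))
  have hs : s ≤ 0 := by
    have := hφ2 (0, 0) ⟨h0, by simp [hf0]⟩
    have hz : φ ((0 : E), (0 : ℝ)) = 0 := φ.map_zero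
    rwa [hz] at this
  set κ := φ (0, 1) with hκ
  have hκpos : 0 < κ := by
    have h1 := hφ1 (0, -1) (by simp)
    have h2 : φ ((0 : E), (-1 : ℝ)) = -κ := by
      rw [hκ, ← map_neg]; simp
    linarith
  have hs0 : 0 ≤ s := by
    by_contra! hneg
    have h1 := hφ1 (0, s / (2 * κ)) (by simpa using div_neg_of_neg_of_pos hneg (by positivity))
    have h2 : φ ((0 : E), s / (2 * κ)) = s / 2 := by
      have : ((0 : E), s / (2 * κ)) = (s / (2 * κ)) • ((0 : E), (1 : ℝ)) := by simp
      rw [this, map_smul, ← hκ, smul_eq_mul]; field_simp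
    linarith
  refine ⟨-(κ⁻¹ • φ.comp (ContinuousLinearMap.inl ℝ E ℝ)), fun u hu => ?_⟩
  have h1 := hφ2 (u, f u) ⟨hu, le_rfl⟩
  have h2 : φ (u, f u) = φ (u, 0) + f u * κ := by
    have : (u, f u) = (u, (0 : ℝ)) + f u • ((0 : E), (1 : ℝ)) := by simp
    rw [this, map_add, map_smul, ← hκ, smul_eq_mul]
  have h3 : 0 ≤ φ (u, 0) + f u * κ := by linarith
  have h4 : -(κ⁻¹ * φ (u, 0)) ≤ f u := by
    rw [← sub_nonneg]
    have : f u - -(κ⁻¹ * φ (u, 0)) = κ⁻¹ * (φ (u, 0) + f u * κ) := by field_simp; ring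
    rw [this]; positivity
  simpa using h4

/-- Every pointwise bounded sequence of functionals on a Banach space has a weak-star limit along
an ultrafilter. -/
theorem exists_weakStar_limit {E : Type*} [NormedAddCommGroup E] [NormedSpace ℝ E]
    [CompleteSpace E] (z : ℕ → StrongDual ℝ E) (hz : ∀ u, ∃ K : ℝ, ∀ n, z n u ≤ K) :
    ∃ ℓ : StrongDual ℝ E, ∀ u, Tendsto (fun n => z n u) (hyperfilter ℕ) (𝓝 (ℓ u)) := by
  obtain ⟨M, hM⟩ : ∃ M, ∀ n, ‖z n‖ ≤ M := by
    refine banach_steinhaus fun u => ?_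
    obtain ⟨K, hK⟩ := hz u
    obtain ⟨K', hK'⟩ := hz (-u)
    refine ⟨max K K', fun n => abs_le.2 ⟨?_, (hK n).trans (le_max_left _ _)⟩⟩
    have h1 := hK' n
    rw [map_neg] at h1
    linarith [le_max_right K K']
  have hcomp := WeakDual.isCompact_closedBall (0 : StrongDual ℝ E) M
  obtain ⟨ℓ, -, hℓ⟩ := hcomp.ultrafilter_le_nhds
    ((hyperfilter ℕ).map fun n => StrongDual.toWeakDual (z n)) (by
      rw [Ultrafilter.coe_map, le_principal_iff, mem_map]
      refine univ_mem' fun n => ?_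
      simpa using hM n)
  refine ⟨WeakDual.toStrongDual ℓ, fun u => ?_⟩
  exact ((WeakDual.eval_continuous u).tendsto ℓ).comp hℓ

/-- Sequential form of lower semicontinuity relative to a set. -/
theorem le_of_lowerSemicontinuousOn {α ι : Type*} [TopologicalSpace α] {C : Set α} {f : α → ℝ}
    (hf : LowerSemicontinuousOn f C) {l : Filter ι} [l.NeBot] {w : ι → α} {b : α} (hb : b ∈ C)
    (hw : Tendsto w l (𝓝 b)) (hwC : ∀ i, w i ∈ C) {g : ι → ℝ} {L : ℝ}
    (hg : Tendsto g l (𝓝 L)) (hfg : ∀ i, f (w i) ≤ g i) : f b ≤ L := by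
  by_contra! hlt
  obtain ⟨m, hLm, hmf⟩ := exists_between hlt
  have hev := (tendsto_nhdsWithin_iff.2 ⟨hw, Eventually.of_forall hwC⟩).eventually (hf b hb m hmf)
  obtain ⟨i, hi, hi'⟩ := (hev.and (hg.eventually (gt_mem_nhds hLm))).exists
  linarith [hfg i]

variable {X : Type*} [NormedAddCommGroup X] [NormedSpace ℝ X]

/-! ### Relative core points and subdifferentiability -/

/-- `w` lies in the core of `C` relative to `w + V`, and `C` is contained in `w + V`. -/
structure IsRelativeCorePoint (C : Set X) (V : Submodule ℝ X) (w : X) : Prop where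
  mem : w ∈ C
  sub_mem : ∀ c ∈ C, c - w ∈ V
  absorbing : ∀ u ∈ V, ∃ δ : ℝ, 0 < δ ∧ w + δ • u ∈ C

theorem exists_isRelativeCorePoint_of_mem_sqri {C : Set X} {p : X} (hp : p ∈ sqri C) :
    ∃ V : Submodule ℝ X, IsClosed (V : Set X) ∧ IsRelativeCorePoint C V p := by
  obtain ⟨hpC, V, hV, hcone⟩ := hp
  refine ⟨V, hV, hpC, fun c hc => ?_, fun u hu => ?_⟩
  · have : c - p ∈ conicalHull ((fun u => u - p) '' C) :=
      ⟨1, zero_le_one, c - p, ⟨c, hc, rfl⟩, (one_smul ℝ _).symm⟩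
    rwa [hcone] at this
  · have hu' : u ∈ conicalHull ((fun u => u - p) '' C) := by rw [hcone]; exact hu
    obtain ⟨t, ht, _, ⟨c, hc, rfl⟩, rfl⟩ := hu'
    rcases ht.eq_or_lt with rfl | htpos
    · exact ⟨1, one_pos, by simpa using hpC⟩
    · refine ⟨t⁻¹, inv_pos.2 htpos, ?_⟩
      rw [smul_smul, inv_mul_cancel₀ htpos.ne', one_smul]
      simpa using hc

/-- Contracting `C` towards `c` by the factor `r` keeps it in `C`, so absorption survives with `r *
δ`. -/
theorem IsRelativeCorePoint.add_smul_sub {C : Set X} (hC : Convex ℝ C) {V : Submodule ℝ X} {p c : X}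
    (hp : IsRelativeCorePoint C V p) (hc : c ∈ C) {r : ℝ} (hr : 0 < r) (hr1 : r ≤ 1) :
    IsRelativeCorePoint C V (c + r • (p - c)) := by
  have hmem : c + r • (p - c) ∈ C := hC.add_smul_sub_mem hc hp.mem ⟨hr.le, hr1⟩
  refine ⟨hmem, fun q hq => ?_, fun u hu => ?_⟩
  · have := V.sub_mem (hp.sub_mem q hq) (hp.sub_mem _ hmem)
    rwa [sub_sub_sub_cancel_right] at this
  · obtain ⟨δ, hδ, hq⟩ := hp.absorbing u hu
    refine ⟨r * δ, by positivity, ?_⟩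
    have := hC.add_smul_sub_mem hc hq ⟨hr.le, hr1⟩
    convert this using 1
    module

/-- Subdifferentiability of lower semicontinuous convex functions at relative core points of their
domain. -/
theorem IsRelativeCorePoint.exists_subgradient [CompleteSpace X] {C : Set X} (hC : IsClosed C)
    {V : Submodule ℝ X} (hV : IsClosed (V : Set X)) {w : X} (hw : IsRelativeCorePoint C V w)
    {g : X → ℝ} (hg : ConvexOn ℝ C g) (hlsc : LowerSemicontinuousOn g C) (hgw : g w = 0) :
    ∃ ℓ : StrongDual ℝ X, ∀ q ∈ C, ℓ (q - w) ≤ g q := by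
  have : CompleteSpace V := hV.completeSpace_coe
  let K : Set V := {u | w + u ∈ C}
  have hKconv : ConvexOn ℝ K (fun u : V => g (w + u)) := by
    refine ⟨fun x hx y hy a b ha hb hab => ?_, fun x hx y hy a b ha hb hab => ?_⟩
    · have := hg.1 hx hy ha hb hab
      have e : a • (w + (x : X)) + b • (w + (y : X)) = w + ((a • x + b • y : V) : X) := by
        push_cast
        obtain rfl : b = 1 - a := by linarith
        module
      rwa [e] at this
    · have := hg.2 hx hy ha hb hab
      have e : a • (w + (x : X)) + b • (w + (y : X)) = w + ((a • x + b • y : V) : X) := by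
        push_cast
        obtain rfl : b = 1 - a := by linarith
        module
      rwa [e] at this
  obtain ⟨ℓ, hℓ⟩ := exists_subgradient_zero (K := K) (f := fun u : V => g (w + u))
    (by simpa [K] using hw.mem)
    (fun u => by simpa [K] using hw.absorbing u u.2) hKconv (by simpa using hgw) (by
      obtain ⟨v, hv, hv'⟩ := lowerSemicontinuousOn_iff_preimage_Iic.1 hlsc 1
      have : IsClosed (C ∩ g ⁻¹' Set.Iic 1) := hv' ▸ hC.inter hv
      exact this.preimage (f := fun u : V => w + (u : X)) (by fun_prop))
  obtain ⟨m, hm, -⟩ := exists_extension_norm_eq V ℓ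
  refine ⟨m, fun q hq => ?_⟩
  have hqV := hw.sub_mem q hq
  have h1 := hℓ ⟨q - w, hqV⟩ (by simpa [K] using hq)
  have h2 := hm ⟨q - w, hqV⟩
  simp only [add_sub_cancel] at h1
  exact h2 ▸ h1

/-! ### The inequality at a related point of `C` -/

section

variable {C : Set X} {F : X → X → ℝ}

theorem exists_lower_bound_segment (hC : Convex ℝ C) {f : X → ℝ}
    (hf : LowerSemicontinuousOn f C) {b q : X} (hb : b ∈ C) (hq : q ∈ C) :
    ∃ K : ℝ, 0 ≤ K ∧ ∀ s ∈ Set.Icc (0 : ℝ) 1, -f (b + s • (q - b)) ≤ K := by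
  have hcomp : IsCompact (segment ℝ b q) := by
    rw [segment_eq_image']
    exact isCompact_Icc.image (by fun_prop)
  obtain ⟨m, hm⟩ := (hf.mono (hC.segment_subset hb hq)).bddBelow_of_isCompact hcomp
  refine ⟨max 0 (-m), le_max_left _ _, fun s hs => ?_⟩
  have := hm ⟨b + s • (q - b), by rw [segment_eq_image']; exact ⟨s, hs, rfl⟩, rfl⟩
  linarith [le_max_right 0 (-m)]

/-- If every `y' ∈ A^F y` satisfies `0 ≤ y' (y - x₀)` and `x₀ ∈ C`, then `F z x₀ ≤ 0` on `C`. -/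
theorem le_zero_of_monotonically_related [CompleteSpace X] (hC : IsClosed C) (hconv : Convex ℝ C)
    {V : Submodule ℝ X} (hV : IsClosed (V : Set X)) {p : X} (hp : IsRelativeCorePoint C V p)
    (hdiag : ∀ x ∈ C, F x x = 0) (hmono : IsMonotoneBifunction C F)
    (hFconv : ∀ x ∈ C, ConvexOn ℝ C (F x)) (hlsc : ∀ x ∈ C, LowerSemicontinuousOn (F x) C)
    {x₀ : X} (hx₀ : x₀ ∈ C)
    (hrel : ∀ y ∈ C, ∀ y' : StrongDual ℝ X, (∀ c ∈ C, y' (c - y) ≤ F y c) → 0 ≤ y' (y - x₀))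
    {z : X} (hz : z ∈ C) : F z x₀ ≤ 0 := by
  have key : ∀ a ∈ Set.Ioo (0 : ℝ) 1, F z (x₀ + a • (z - x₀)) ≤ 0 := by
    rintro a ⟨ha, ha1⟩
    have hb := hconv.add_smul_sub_mem hx₀ hz ⟨ha.le, ha1.le⟩
    set b := x₀ + a • (z - x₀) with hbdef
    -- This point is `a • z + (1 - a) • p`.
    have hq : b + (1 - a) • (p - x₀) ∈ C := by
      have := hconv.add_smul_sub_mem hz hp.mem (t := 1 - a) ⟨by linarith, by linarith⟩
      convert this using 1
      rw [hbdef]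
      module
    set q := b + (1 - a) • (p - x₀) with hqdef
    obtain ⟨K, hK0, hK⟩ := exists_lower_bound_segment hconv (hlsc q hq) hb hq
    have main : ∀ s : ℝ, 0 < s → s ≤ 1 / 2 →
        b + s • (q - b) ∈ C ∧ F z (b + s • (q - b)) ≤ 2 * K / a * s := by
      intro s hs hs2
      have hσ : 0 < 1 - s * (1 - a) := by nlinarith
      have hwcore : IsRelativeCorePoint C V (b + s • (q - b)) := by
        -- The point of `[x₀, z]` whose segment to `p` passes through `b + s • (q - b)`.
        have hc := hconv.add_smul_sub_mem hx₀ hz (t := a / (1 - s * (1 - a)))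
          ⟨by positivity, by rw [div_le_one hσ]; nlinarith⟩
        have := hp.add_smul_sub hconv hc (r := s * (1 - a)) (by nlinarith) (by nlinarith)
        convert this using 1
        have e : (1 - s * (1 - a)) • (a / (1 - s * (1 - a))) • (z - x₀) = a • (z - x₀) := by
          rw [smul_smul, mul_div_cancel₀ _ hσ.ne']
        calc b + s • (q - b) = x₀ + a • (z - x₀) + (s * (1 - a)) • (p - x₀) := by
              rw [hqdef, hbdef]; module
          _ = x₀ + (1 - s * (1 - a)) • (a / (1 - s * (1 - a))) • (z - x₀)
              + (s * (1 - a)) • (p - x₀) := by rw [e]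
          _ = _ := by module
      set w := b + s • (q - b) with hwdef
      have hw := hwcore.mem
      obtain ⟨y, hy⟩ := hwcore.exists_subgradient hC hV (hFconv w hw) (hlsc w hw) (hdiag w hw)
      refine ⟨hw, ?_⟩
      have h1 := hrel w hw y hy
      have h2 := hy q hq
      have h3 := hmono w hw q hq
      have h4 := hK s ⟨hs.le, by linarith⟩
      have h5 := hmono z hz w hw
      have h6 := hy z hz
      have e1 : w - x₀ = a • (z - x₀) + (s * (1 - a)) • (p - x₀) := by
        rw [hwdef, hqdef, hbdef]; module
      have e2 : q - w = ((1 - s) * (1 - a)) • (p - x₀) := by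
        rw [hwdef, hqdef]; module
      have e3 : z - w = (1 - a) • (z - x₀) - (s * (1 - a)) • (p - x₀) := by
        rw [hwdef, hqdef, hbdef]; module
      rw [e1, map_add, map_smul, map_smul, smul_eq_mul, smul_eq_mul] at h1
      rw [e2, map_smul, smul_eq_mul] at h2
      rw [e3, map_sub, map_smul, map_smul, smul_eq_mul, smul_eq_mul] at h6
      generalize y (z - x₀) = Z at *
      generalize y (p - x₀) = P at *
      have hP : (1 - s) * ((1 - a) * P) ≤ K := by linarith
      have hP2 : (1 - a) * P ≤ 2 * K := by nlinarith
      have h7 : F z w ≤ -((1 - a) * Z) + s * ((1 - a) * P) := by linarith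
      -- Eliminates `Z` through the relation `h1`; only `P`, bounded above via `q`, remains.
      have h8 : a * F z w ≤ s * ((1 - a) * P) := by nlinarith
      have h9 : a * F z w ≤ s * (2 * K) := h8.trans (by gcongr)
      rw [show 2 * K / a * s = s * (2 * K) / a by ring, le_div_iff₀ ha]
      linarith
    have hpos : ∀ n : ℕ, (0 : ℝ) < 1 / ((n : ℝ) + 1) / 2 := fun n => by positivity
    have hle : ∀ n : ℕ, (1 : ℝ) / ((n : ℝ) + 1) / 2 ≤ 1 / 2 := fun n => by
      have : (1 : ℝ) / ((n : ℝ) + 1) ≤ 1 := by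
        rw [div_le_one (by positivity)]; linarith [(Nat.cast_nonneg n : (0 : ℝ) ≤ n)]
      linarith
    have hlim : Tendsto (fun n : ℕ => (1 : ℝ) / ((n : ℝ) + 1) / 2) atTop (𝓝 0) := by
      simpa using (tendsto_one_div_add_atTop_nhds_zero_nat (𝕜 := ℝ)).div_const 2
    refine le_of_lowerSemicontinuousOn (hlsc z hz) hb
      (w := fun n : ℕ => b + (1 / ((n : ℝ) + 1) / 2) • (q - b))
      (g := fun n : ℕ => 2 * K / a * (1 / ((n : ℝ) + 1) / 2)) (l := atTop) ?_
      (fun n => (main _ (hpos n) (hle n)).1) ?_ (fun n => (main _ (hpos n) (hle n)).2)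
    · simpa using (hlim.smul_const (q - b)).const_add b
    · simpa using hlim.const_mul (2 * K / a)
  have hmem : ∀ n : ℕ, (1 : ℝ) / ((n : ℝ) + 2) ∈ Set.Ioo (0 : ℝ) 1 := fun n =>
    ⟨by positivity, by
      rw [div_lt_one (by positivity)]; linarith [(Nat.cast_nonneg n : (0 : ℝ) ≤ n)]⟩
  have hlim : Tendsto (fun n : ℕ => (1 : ℝ) / ((n : ℝ) + 2)) atTop (𝓝 0) := by
    have := (tendsto_one_div_add_atTop_nhds_zero_nat (𝕜 := ℝ)).comp (tendsto_add_atTop_nat 1)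
    refine this.congr fun n => ?_
    simp only [Function.comp_apply]; push_cast; ring
  refine le_of_lowerSemicontinuousOn (hlsc z hz) hx₀
    (w := fun n : ℕ => x₀ + (1 / ((n : ℝ) + 2)) • (z - x₀)) (g := fun _ => 0) (l := atTop) ?_
    (fun n => hconv.add_smul_sub_mem hx₀ hz ⟨(hmem n).1.le, (hmem n).2.le⟩)
    tendsto_const_nhds (fun n => key _ (hmem n))
  simpa using (hlim.smul_const (z - x₀)).const_add x₀

/-! ### Membership of a related point in `C` -/

/-- Adding normal functionals keeps a subgradient a subgradient, so none can be negative in the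
direction `b - x₀`. -/
theorem nonneg_of_normal {x₀ b : X}
    (hrel : ∀ y ∈ C, ∀ y' : StrongDual ℝ X, (∀ c ∈ C, y' (c - y) ≤ F y c) → 0 ≤ y' (y - x₀))
    (hb : b ∈ C) {ℓ m : StrongDual ℝ X} (hℓ : ∀ c ∈ C, ℓ (c - b) ≤ F b c)
    (hm : ∀ c ∈ C, m (c - b) ≤ 0) : 0 ≤ m (b - x₀) := by
  by_contra! hneg
  have hℓ0 := hrel b hb ℓ hℓ
  -- The coefficient makes the sum equal `-1` at `b - x₀`.
  have h := hrel b hb (ℓ + ((ℓ (b - x₀) + 1) / -m (b - x₀)) • m) fun c hc => by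
    have h1 : 0 ≤ (ℓ (b - x₀) + 1) / -m (b - x₀) := div_nonneg (by linarith) (by linarith)
    have h2 := mul_nonpos_of_nonneg_of_nonpos h1 (hm c hc)
    simp only [add_apply, smul_apply, smul_eq_mul]
    linarith [hℓ c hc]
  simp only [add_apply, smul_apply, smul_eq_mul] at h
  have e : (ℓ (b - x₀) + 1) / -m (b - x₀) * m (b - x₀) = -(ℓ (b - x₀) + 1) := by
    rw [div_neg, neg_mul, div_mul_cancel₀ _ hneg.ne]
  linarith

/-- A functional vanishing on a closed subspace and negative at a given point outside it. -/
theorem exists_vanishing_functional {V : Submodule ℝ X} (hV : IsClosed (V : Set X)) {d : X}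
    (hd : d ∉ V) : ∃ m : StrongDual ℝ X, (∀ v ∈ V, m v = 0) ∧ m d < 0 := by
  obtain ⟨m, s, hms, hmV⟩ := geometric_hahn_banach_point_closed V.convex hV hd
  have hzero : ∀ v ∈ V, m v = 0 := by
    intro v hv
    by_contra hne
    -- At this multiple `m` takes the value `m d`, which is below `s`.
    have := hmV ((m d / m v) • v) (V.smul_mem _ hv)
    rw [map_smul, smul_eq_mul, div_mul_cancel₀ _ hne] at this
    linarith
  refine ⟨m, hzero, ?_⟩
  have := hmV 0 V.zero_mem
  rw [map_zero] at this
  linarith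

/-- Supporting functional at a point `b` of `C` that the line from the relative core point `p`
leaves at `b`. -/
theorem IsRelativeCorePoint.exists_support [CompleteSpace X] (hC : IsClosed C) (hconv : Convex ℝ C)
    {V : Submodule ℝ X} (hV : IsClosed (V : Set X)) {p b d : X} (hp : IsRelativeCorePoint C V p)
    (hb : b ∈ C) (hd : d ∈ V) (hleave : ∀ ε : ℝ, 0 < ε → b + ε • d ∉ C) :
    ∃ m : StrongDual ℝ X, (∀ c ∈ C, m (c - b) ≤ 0) ∧ 0 < m (b - p) := by
  have : CompleteSpace V := hV.completeSpace_coe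
  let K : Set V := {u | p + u ∈ C}
  have hKclosed : IsClosed K := hC.preimage (f := fun u : V => p + (u : X)) (by fun_prop)
  have hKconv : Convex ℝ K := by
    intro x hx y hy s t hs ht hst
    have := hconv hx hy hs ht hst
    have e : s • (p + (x : X)) + t • (p + (y : X)) = p + ((s • x + t • y : V) : X) := by
      push_cast
      obtain rfl : t = 1 - s := by linarith
      module
    rwa [e] at this
  have hint : (0 : V) ∈ interior K := zero_mem_interior_of_absorbing hKclosed hKconv
    (by simpa [K] using hp.mem) (fun u => by simpa [K] using hp.absorbing u u.2)
  let β : V := ⟨b - p, hp.sub_mem b hb⟩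
  have hβ : β ∉ interior K := by
    intro hβ
    have hlim : Tendsto (fun ε : ℝ => β + ε • (⟨d, hd⟩ : V)) (𝓝[>] 0) (𝓝 β) := by
      have : Tendsto (fun ε : ℝ => β + ε • (⟨d, hd⟩ : V)) (𝓝 0) (𝓝 (β + (0 : ℝ) • ⟨d, hd⟩)) :=
        Continuous.tendsto (by fun_prop) 0
      rw [zero_smul, add_zero] at this
      exact this.mono_left nhdsWithin_le_nhds
    obtain ⟨ε, hε, hε0⟩ := ((hlim.eventually (mem_interior_iff_mem_nhds.1 hβ)).and
      self_mem_nhdsWithin).exists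
    refine hleave ε hε0 ?_
    have h : p + ((β + ε • (⟨d, hd⟩ : V) : V) : X) ∈ C := hε
    convert h using 1
    simp only [β, Submodule.coe_add, Submodule.coe_smul]
    module
  obtain ⟨n, hn⟩ := geometric_hahn_banach_open_point hKconv.interior isOpen_interior hβ
  have hnK : ∀ k ∈ K, n k ≤ n β := by
    intro k hk
    -- Separation holds only on the interior; `r • k` is interior for `r < 1`, and `r → 1`.
    have hev : ∀ᶠ r : ℝ in 𝓝[<] 1, r * n k ≤ n β := by
      filter_upwards [Ioo_mem_nhdsLT (zero_lt_one' ℝ)] with r hr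
      have := hKconv.combo_interior_self_mem_interior hint hk (a := 1 - r) (b := r)
        (by linarith [hr.2]) hr.1.le (by ring)
      have := hn _ this
      simp only [smul_zero, zero_add, map_smul, smul_eq_mul] at this
      exact this.le
    have hlim : Tendsto (fun r : ℝ => r * n k) (𝓝[<] 1) (𝓝 (1 * n k)) :=
      (Continuous.tendsto (by fun_prop) 1).mono_left nhdsWithin_le_nhds
    simpa using le_of_tendsto hlim hev
  obtain ⟨m, hm, -⟩ := exists_extension_norm_eq V n
  refine ⟨m, fun c hc => ?_, ?_⟩
  · have h1 := hnK ⟨c - p, hp.sub_mem c hc⟩ (by simpa [K] using hc)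
    rw [← hm, ← hm] at h1
    have : c - b = (c - p) - (b - p) := by abel
    rw [this, map_sub]
    exact sub_nonpos.2 h1
  · have := hn 0 hint
    rw [map_zero, ← hm] at this
    exact this

/-- If `y'(p - x₀)` stays nonnegative for the subgradients along the half-open segment from `p` to
`b`, and `b ∈ [x₀, p]`, then `A^F b` is nonempty. -/
theorem exists_subgradient_of_segment [CompleteSpace X] (hC : IsClosed C) (hconv : Convex ℝ C)
    {V : Submodule ℝ X} (hV : IsClosed (V : Set X)) {p : X} (hp : IsRelativeCorePoint C V p)
    (hdiag : ∀ x ∈ C, F x x = 0) (hBO : IsBOMaximalMonotoneBifunction C F)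
    (hFconv : ∀ x ∈ C, ConvexOn ℝ C (F x)) (hlsc : ∀ x ∈ C, LowerSemicontinuousOn (F x) C)
    {x₀ b : X} {t : ℝ} (ht : 0 < t) (ht1 : t ≤ 1) (hb : b ∈ C) (hbt : b = x₀ + t • (p - x₀))
    (hrel : ∀ y ∈ C, ∀ y' : StrongDual ℝ X, (∀ c ∈ C, y' (c - y) ≤ F y c) → 0 ≤ y' (y - x₀)) :
    ∃ ℓ : StrongDual ℝ X, ∀ c ∈ C, ℓ (c - b) ≤ F b c := by
  have : CompleteSpace V := hV.completeSpace_coe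
  let r : ℕ → ℝ := fun n => 1 / ((n : ℝ) + 1)
  have hr : ∀ n, 0 < r n := fun n => by positivity
  have hr1 : ∀ n, r n ≤ 1 := fun n => by
    rw [div_le_one (by positivity)]; linarith [(Nat.cast_nonneg n : (0 : ℝ) ≤ n)]
  have hrlim : Tendsto r (hyperfilter ℕ) (𝓝 0) :=
    (tendsto_one_div_add_atTop_nhds_zero_nat (𝕜 := ℝ)).mono_left
      (Nat.cofinite_eq_atTop ▸ hyperfilter_le_cofinite)
  let w : ℕ → X := fun n => b + r n • (p - b)
  have hcore : ∀ n, IsRelativeCorePoint C V (w n) := fun n =>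
    hp.add_smul_sub hconv hb (hr n) (hr1 n)
  choose y hy using fun n => (hcore n).exists_subgradient hC hV (hFconv _ (hcore n).mem)
    (hlsc _ (hcore n).mem) (hdiag _ (hcore n).mem)
  have hyp : ∀ n, 0 ≤ y n (p - x₀) := by
    intro n
    have h1 := hrel _ (hcore n).mem (y n) (hy n)
    have e : w n - x₀ = (t + r n * (1 - t)) • (p - x₀) := by
      simp only [w, hbt]; module
    rw [e, map_smul, smul_eq_mul] at h1
    refine nonneg_of_mul_nonneg_right h1 ?_
    have := mul_nonneg (hr n).le (sub_nonneg.2 ht1)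
    linarith
  have hFle : ∀ q ∈ C, ∀ n, F q (w n) ≤ y n (w n - q) := by
    intro q hq n
    have h1 := hy n q hq
    have h2 := hBO.1 _ (hcore n).mem q hq
    rw [← neg_sub q, map_neg]
    linarith
  obtain ⟨ℓ, hℓ⟩ := exists_weakStar_limit (fun n => (y n).comp V.subtypeL) (by
    intro u
    obtain ⟨δ, hδ, hq⟩ := hp.absorbing u u.2
    obtain ⟨K, -, hK⟩ := exists_lower_bound_segment hconv (hlsc _ hq) hb hp.mem
    refine ⟨K / δ, fun n => ?_⟩
    have h1 := hFle _ hq n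
    have h2 := hK (r n) ⟨(hr n).le, hr1 n⟩
    have e : w n - (p + δ • (u : X)) = -(((1 - r n) * (1 - t)) • (p - x₀) + δ • (u : X)) := by
      simp only [w, hbt]; module
    rw [e, map_neg, map_add, map_smul, map_smul, smul_eq_mul, smul_eq_mul] at h1
    -- The relation with `x₀` gives this term a sign, so it can be dropped from the upper bound.
    have h3 := mul_nonneg (mul_nonneg (sub_nonneg.2 (hr1 n)) (sub_nonneg.2 ht1)) (hyp n)
    rw [le_div_iff₀ hδ]
    change y n (u : X) * δ ≤ K
    simp only [w] at h1
    linarith)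
  obtain ⟨m, hm, -⟩ := exists_extension_norm_eq V ℓ
  have hlim : ∀ v ∈ V, Tendsto (fun n => y n v) (hyperfilter ℕ) (𝓝 (m v)) := by
    intro v hv
    have := hℓ ⟨v, hv⟩
    rw [← hm] at this
    exact this
  refine ⟨m, hBO.2 b hb m fun q hq => ?_⟩
  have hbq : b - q ∈ V := by
    have := V.sub_mem (hp.sub_mem b hb) (hp.sub_mem q hq)
    rwa [sub_sub_sub_cancel_right] at this
  have hpb : p - b ∈ V := by
    have := V.neg_mem (hp.sub_mem b hb)
    rwa [neg_sub] at this
  have hg : Tendsto (fun n => y n (w n - q)) (hyperfilter ℕ) (𝓝 (m (b - q))) := by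
    have h := (hlim _ hbq).add (hrlim.mul (hlim _ hpb))
    rw [zero_mul, add_zero] at h
    refine h.congr fun n => ?_
    have e : w n - q = (b - q) + r n • (p - b) := by simp only [w]; module
    rw [e, map_add, map_smul, smul_eq_mul]
  have hw : Tendsto w (hyperfilter ℕ) (𝓝 b) := by
    simpa using (hrlim.smul_const (p - b)).const_add b
  have := le_of_lowerSemicontinuousOn (hlsc q hq) hb hw (fun n => (hcore n).mem) hg (hFle q hq)
  rw [← neg_sub q, map_neg] at this
  linarith

/-- A point outside `C` is excluded by a normal functional: at `p` if `p - x₀` leaves `V`, otherwise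
where `[x₀, p]` enters `C`. -/
theorem mem_of_monotonically_related [CompleteSpace X] (hC : IsClosed C) (hconv : Convex ℝ C)
    {V : Submodule ℝ X} (hV : IsClosed (V : Set X)) {p : X} (hp : IsRelativeCorePoint C V p)
    (hdiag : ∀ x ∈ C, F x x = 0) (hBO : IsBOMaximalMonotoneBifunction C F)
    (hFconv : ∀ x ∈ C, ConvexOn ℝ C (F x)) (hlsc : ∀ x ∈ C, LowerSemicontinuousOn (F x) C)
    {x₀ : X}
    (hrel : ∀ y ∈ C, ∀ y' : StrongDual ℝ X, (∀ c ∈ C, y' (c - y) ≤ F y c) → 0 ≤ y' (y - x₀)) :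
    x₀ ∈ C := by
  by_contra hx₀
  by_cases hd : p - x₀ ∈ V
  · have hT : IsCompact (Set.Icc (0 : ℝ) 1 ∩ (fun t : ℝ => x₀ + t • (p - x₀)) ⁻¹' C) :=
      isCompact_Icc.inter_right (hC.preimage (by fun_prop))
    obtain ⟨t, ⟨⟨ht0, ht1⟩, htC⟩, hleast⟩ := hT.exists_isLeast
      ⟨1, ⟨zero_le_one, le_rfl⟩, by simpa using hp.mem⟩
    have ht : 0 < t := by
      refine ht0.lt_of_ne fun h => hx₀ ?_
      subst h
      simpa using htC
    set b := x₀ + t • (p - x₀) with hb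
    have hbC : b ∈ C := htC
    obtain ⟨m, hm, hmp⟩ := hp.exists_support hC hconv hV hbC (V.neg_mem hd) (by
      -- For `ε ≤ t` the minimality of `t` fails; for `ε > t` convexity puts `x₀` in `C`.
      intro ε hε hmem
      rcases le_or_gt ε t with hle | hlt
      · have := hleast (show t - ε ∈ _ from ⟨⟨by linarith, by linarith⟩, by
          change x₀ + (t - ε) • (p - x₀) ∈ C
          convert hmem using 1
          rw [hb]; module⟩)
        linarith
      · refine hx₀ ?_
        have := hconv.add_smul_sub_mem hbC hmem (t := t / ε)
          ⟨by positivity, by rw [div_le_one hε]; exact hlt.le⟩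
        convert this using 1
        rw [add_sub_cancel_left, smul_smul, div_mul_cancel₀ _ hε.ne', hb]
        module)
    obtain ⟨ℓ, hℓ⟩ := exists_subgradient_of_segment hC hconv hV hp hdiag hBO hFconv hlsc ht ht1
      hbC hb hrel
    have h1 := nonneg_of_normal hrel hbC hℓ hm
    have e1 : b - x₀ = t • (p - x₀) := by rw [hb]; module
    have e2 : b - p = (-(1 - t)) • (p - x₀) := by rw [hb]; module
    rw [e1, map_smul, smul_eq_mul] at h1
    rw [e2, map_smul, smul_eq_mul] at hmp
    have h2 := nonneg_of_mul_nonneg_right h1 ht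
    nlinarith [mul_nonneg (sub_nonneg.2 ht1) h2]
  · obtain ⟨m, hm, hmd⟩ := exists_vanishing_functional hV hd
    obtain ⟨ℓ, hℓ⟩ := hp.exists_subgradient hC hV (hFconv p hp.mem) (hlsc p hp.mem)
      (hdiag p hp.mem)
    exact absurd (nonneg_of_normal hrel hp.mem hℓ fun c hc => (hm _ (hp.sub_mem c hc)).le)
      (not_le.2 hmd)

/-! ### Reduction to the zero functional and maximality -/

/-- Subtracting the affine bifunction `(x, y) ↦ x' (y - x)` preserves Blum-Oettli maximality. -/
theorem IsBOMaximalMonotoneBifunction.sub_affine (hBO : IsBOMaximalMonotoneBifunction C F)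
    (x' : StrongDual ℝ X) :
    IsBOMaximalMonotoneBifunction C (fun x y => F x y - x' (y - x)) := by
  refine ⟨fun x hx y hy => ?_, fun x hx y' h y hy => ?_⟩
  · have h1 := hBO.1 x hx y hy
    have h2 : x' (x - y) = -x' (y - x) := by rw [← neg_sub y, map_neg]
    simp only [h2]
    linarith
  · have := hBO.2 x hx (y' + x') (fun c hc => by
      have h1 := h c hc
      have h2 : x' (x - c) = -x' (c - x) := by rw [← neg_sub c, map_neg]
      simp only [h2] at h1
      rw [add_apply]
      linarith) y hy
    rw [add_apply] at this
    linarith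

theorem isMonotoneOperator_diagonalOperator (hdiag : ∀ x ∈ C, F x x = 0)
    (hmono : IsMonotoneBifunction C F) : IsMonotoneOperator (diagonalOperator C F) := by
  rintro x y x' ⟨hx, hx'⟩ y' ⟨hy, hy'⟩
  have h1 := hx' y hy
  have h2 := hy' x hx
  have h3 := hmono x hx y hy
  rw [hdiag x hx, sub_zero] at h1
  rw [hdiag y hy, sub_zero, ← neg_sub y, map_neg] at h2
  rw [sub_apply]
  linarith

/-- Any pair monotonically related to the graph of `A^F` belongs to it. -/
theorem mem_diagonalOperator_of_monotonically_related [CompleteSpace X] (hC : IsClosed C)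
    (hconv : Convex ℝ C) (hsqri : (sqri C).Nonempty) (hdiag : ∀ x ∈ C, F x x = 0)
    (hBO : IsBOMaximalMonotoneBifunction C F) (hFconv : ∀ x ∈ C, ConvexOn ℝ C (F x))
    (hlsc : ∀ x ∈ C, LowerSemicontinuousOn (F x) C) {x₀ : X} {x' : StrongDual ℝ X}
    (hrel : ∀ y, ∀ y' ∈ diagonalOperator C F y, 0 ≤ (y' - x') (y - x₀)) :
    x' ∈ diagonalOperator C F x₀ := by
  obtain ⟨p, hp⟩ := hsqri
  obtain ⟨V, hV, hcore⟩ := exists_isRelativeCorePoint_of_mem_sqri hp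
  let G : X → X → ℝ := fun x y => F x y - x' (y - x)
  have hGBO : IsBOMaximalMonotoneBifunction C G := hBO.sub_affine x'
  have hGdiag : ∀ x ∈ C, G x x = 0 := fun x hx => by simp [G, hdiag x hx]
  have hGconv : ∀ x ∈ C, ConvexOn ℝ C (G x) := fun x hx => by
    refine ⟨hconv, fun u hu v hv a b ha hb hab => ?_⟩
    have h1 := (hFconv x hx).2 hu hv ha hb hab
    obtain rfl : b = 1 - a := by linarith
    simp only [G, map_sub, map_add, map_smul, smul_eq_mul] at h1 ⊢
    linarith
  have hGlsc : ∀ x ∈ C, LowerSemicontinuousOn (G x) C := fun x hx => by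
    have hcont : Continuous fun y => -x' (y - x) := by fun_prop
    exact (hlsc x hx).add (hcont.lowerSemicontinuous.lowerSemicontinuousOn C)
  have hGrel : ∀ y ∈ C, ∀ y' : StrongDual ℝ X, (∀ c ∈ C, y' (c - y) ≤ G y c) →
      0 ≤ y' (y - x₀) := by
    intro y hy y' h
    have := hrel y (y' + x') ⟨hy, fun c hc => by
      have := h c hc
      rw [hdiag y hy, add_apply]
      simp only [G] at this
      linarith⟩
    rwa [add_sub_cancel_right] at this
  have hx₀ := mem_of_monotonically_related hC hconv hV hcore hGdiag hGBO hGconv hGlsc hGrel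
  refine ⟨hx₀, fun y hy => ?_⟩
  have := hGBO.2 x₀ hx₀ 0 (fun z hz => by
    simpa using le_zero_of_monotonically_related hC hconv hV hcore hGdiag hGBO.1 hGconv hGlsc
      hx₀ hGrel hz) y hy
  simp only [zero_apply, G] at this
  rw [hdiag x₀ hx₀]
  linarith

end

end BifunctionTheory

theorem mainTheorem10 {X : Type*} [NormedAddCommGroup X] [NormedSpace ℝ X] [CompleteSpace X]
    (C : Set X) (hCclosed : IsClosed C) (hCconvex : Convex ℝ C)
    (hCsqri : (BifunctionTheory.sqri C).Nonempty)
    (F : X → X → ℝ) (hFdiag : ∀ x ∈ C, F x x = 0)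
    (hFBO : BifunctionTheory.IsBOMaximalMonotoneBifunction C F)
    (hFconvex : ∀ x ∈ C, ConvexOn ℝ C (F x))
    (hFlsc : ∀ x ∈ C, LowerSemicontinuousOn (F x) C) :
    BifunctionTheory.IsMaximalMonotoneBifunction C F := by
  refine ⟨hFBO.1, BifunctionTheory.isMonotoneOperator_diagonalOperator hFdiag hFBO.1, ?_⟩
  intro S hS hsub
  refine hsub.2 fun q hq => ?_
  refine BifunctionTheory.mem_diagonalOperator_of_monotonically_related hCclosed hCconvex hCsqri
    hFdiag hFBO hFconvex hFlsc fun y y' hy' => ?_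
  have hmem : (y, y') ∈ BifunctionTheory.graph S := hsub.1 hy'
  exact hS q.1 y q.2 hq y' hmem
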